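/- Let $n\ge 1$ and let $(T^n,\alpha(T))$ be a Puiseux parametrisation, i.e. $\alpha=\sum_{i\ge 1}a_iT^i\in\mathbb{C}[[T]]$ and $\gcd(\{n\}\cup\operatorname{supp}\alpha)=1$, where $\operatorname{supp}\alpha=\{i: a_i\ne 0\}$. Let $(b_0,b_1,\dots,b_m)$ be its characteristic, i.e. the unique sequence with $b_0=n$, $b_{k+1}=\min(\operatorname{supp}\alpha\setminus\gcd(b_0,\dots,b_k)\mathbb{N})$ for $0\le k<m$, and $\gcd(b_0,\dots,b_m)=1$. Put $e_k=\gcd(b_0,\dots,b_k)$ and $$I=e_0\mathbb{N}_{+}\cup\bigcup_{k=1}^m\bigl(e_k\mathbb{N}\cap[b_k,+\infty)\bigr).$$ Let $A=(A_i)_{i\in I}$ and $C=(C_{ij})_{i,j\ge 0}$ be families of variables, let $U_n=\{\varepsilon\in\mathbb{C}:\varepsilon^n=1\}$, and let $F=(F_{ij})_{i,j\ge 0}$ be the polynomials $F_{ij}\in\mathbb{C}[A]$ determined by $$\sum_{i,j\ge 0}F_{ij}\,T^{ni}Y^j=\prod_{\varepsilon\in U_n}\Bigl(Y-\sum_{i\in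 I}A_i\varepsilon^iT^i\Bigr);$$ that is, $F_{ij}$ expresses the coefficient $c_{ij}$ of the Weierstrass polynomial $f=\sum c_{ij}X^iY^j$ with $f(T^n,Y)=\prod_{\varepsilon\in U_n}(Y-\alpha(\varepsilon T))$ as a polynomial in the coefficients of $\alpha$. Let $Q\in\mathbb{C}[A]$ be $U_n$-invariant, i.e. for every $\varepsilon\in U_n$ the polynomial $Q$ is unchanged by the substitution $A_i\mapsto\varepsilon^iA_i$ $(i\in I)$. Then there exist polynomials $V,W\in\mathbb{C}[C]$ such that $V(F)$ is a monomial $A_{b_1}^{d_1}\cdots A_{b_m}^{d_m}$ with $d_1,\dots,d_m\ge 0$ (in particular $V(F)\neq 0$) and $$Q=\frac{W(F)}{V(F)}$$ in the field of fractions of $\mathbb{C}[A]$. -/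

import Mathlib

open scoped Polynomial PowerSeries

noncomputable section

namespace PlaneBranch

/-- The support of a power series `α = ∑ aᵢ Tⁱ`: the set of `i` with `aᵢ ≠ 0`. -/
def supp (α : ℂ⟦X⟧) : Set ℕ := {i | PowerSeries.coeff i α ≠ 0}

/-- `(Tⁿ, α(T))` is a Puiseux parametrisation: `n` is positive, `α` has no constant term, and
the greatest common divisor of `{n} ∪ supp α` is `1`. -/
structure IsPuiseuxParametrisation (n : ℕ) (α : ℂ⟦X⟧) : Prop where
  pos : 0 < n
  constantCoeff_eq_zero : PowerSeries.constantCoeff α = 0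
  gcd_eq_one : ∀ d : ℕ, (∀ i ∈ insert n (supp α), d ∣ i) → d = 1

/-- `e k = gcd (b₀, …, b_k)`. -/
def e {m : ℕ} (b : Fin (m + 1) → ℕ) (k : Fin (m + 1)) : ℕ := (Finset.Iic k).gcd b

/-- `(b₀, …, b_m)` is the characteristic of `(Tⁿ, α(T))`. -/
structure IsCharacteristic {m : ℕ} (n : ℕ) (α : ℂ⟦X⟧) (b : Fin (m + 1) → ℕ) : Prop where
  zero_eq : b 0 = n
  isLeast : ∀ k : Fin m, IsLeast (supp α \ {i | e b k.castSucc ∣ i}) (b k.succ)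
  gcd_eq_one : e b (Fin.last m) = 1

/-- The index set `I = e₀ℕ₊ ∪ ⋃_{k = 1}^m (e_k ℕ ∩ [b_k, ∞))` attached to `(b₀, …, b_m)`. -/
def I {m : ℕ} (b : Fin (m + 1) → ℕ) : Set ℕ :=
  {i | 0 < i ∧ e b 0 ∣ i} ∪ ⋃ k : Fin m, {i | e b k.succ ∣ i ∧ b k.succ ≤ i}

theorem mem_I {m : ℕ} (b : Fin (m + 1) → ℕ) (k : Fin m) : b k.succ ∈ I b :=
  Or.inr (Set.mem_iUnion.2 ⟨k, Finset.gcd_dvd (Finset.mem_Iic.2 le_rfl), le_rfl⟩)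

/-- The polynomial ring `ℂ[A]` in the variables `A = (Aᵢ)_{i ∈ I}`. -/
abbrev PolyA {m : ℕ} (b : Fin (m + 1) → ℕ) : Type := MvPolynomial (I b) ℂ

/-- The polynomial ring `ℂ[C]` in the variables `C = (C_{ij})`, `i, j ≥ 0`. -/
abbrev PolyC : Type := MvPolynomial (ℕ × ℕ) ℂ

/-- The variable `A_{b_{k+1}}`, for `k = 0, …, m - 1`. -/
def varAb {m : ℕ} (b : Fin (m + 1) → ℕ) (k : Fin m) : PolyA b :=
  MvPolynomial.X ⟨b k.succ, mem_I b k⟩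

/-- `Q ∈ ℂ[A]` is `U_n`-invariant: the substitution `Aᵢ ↦ εⁱ Aᵢ` fixes `Q` for each `ε` with
`εⁿ = 1`. -/
def IsUInvariant {m : ℕ} (b : Fin (m + 1) → ℕ) (n : ℕ) (Q : PolyA b) : Prop :=
  ∀ ε : ℂ, ε ^ n = 1 →
    MvPolynomial.aeval (fun i : I b => MvPolynomial.C (ε ^ (i : ℕ)) * MvPolynomial.X i) Q = Q

/-- The product `∏_{ε ∈ U_n} (Y - α(εT))`, a polynomial in `Y` over the power series in `T`, for
a power series `α` with coefficients in a `ℂ`-algebra. -/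
def conjProd {R : Type*} [CommRing R] [Algebra ℂ R] (n : ℕ) (α : R⟦X⟧) : R⟦X⟧[X] :=
  ∏ ε ∈ Polynomial.nthRootsFinset n (1 : ℂ),
    (Polynomial.X - Polynomial.C (PowerSeries.rescale (algebraMap ℂ R ε) α))

/-- The coefficient `c_{ij}` at `XⁱYʲ` of the Weierstrass polynomial `f(X, Y)` that is determined
by `f(Tⁿ, Y) = ∏_{ε ∈ U_n} (Y - α(εT))`, that is, the coefficient at `T^{ni}Yʲ` of the product.
(The coefficients at `T^k Yʲ` with `k` not divisible by `n` are zero, see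
`coeff_conjProd_eq_zero`.) -/
def weierstrassCoeff {R : Type*} [CommRing R] [Algebra ℂ R] (n : ℕ) (α : R⟦X⟧) (i j : ℕ) : R :=
  PowerSeries.coeff (n * i) ((conjProd n α).coeff j)

/-- The product is a polynomial in `Y` over the power series in `Tⁿ`. -/
theorem coeff_conjProd_eq_zero {R : Type*} [CommRing R] [Algebra ℂ R] {n : ℕ} (hn : 0 < n)
    (α : R⟦X⟧) (j k : ℕ) (hk : ¬ n ∣ k) :
    PowerSeries.coeff k ((conjProd n α).coeff j) = 0 := by
  have hn0 : n ≠ 0 := hn.ne'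
  obtain ⟨ζ, hζ⟩ : ∃ ζ : ℂ, IsPrimitiveRoot ζ n := ⟨_, Complex.isPrimitiveRoot_exp n hn0⟩
  have hζ0 : ζ ≠ 0 := hζ.ne_zero hn0
  have hinv : (conjProd n α).map (PowerSeries.rescale (algebraMap ℂ R ζ)) = conjProd n α := by
    unfold conjProd
    rw [Polynomial.map_prod]
    refine Finset.prod_bij (fun ε _ => ε * ζ) ?_ ?_ ?_ ?_
    · intro ε hε
      rw [Polynomial.mem_nthRootsFinset hn] at hε ⊢
      rw [mul_pow, hε, hζ.pow_eq_one, one_mul]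
    · intro a _ c _ h
      exact mul_right_cancel₀ hζ0 h
    · intro c hc
      rw [Polynomial.mem_nthRootsFinset hn] at hc
      refine ⟨c * ζ⁻¹, ?_, by field_simp⟩
      rw [Polynomial.mem_nthRootsFinset hn, mul_pow, hc, inv_pow, hζ.pow_eq_one, inv_one, one_mul]
    · intro ε _
      rw [Polynomial.map_sub, Polynomial.map_X, Polynomial.map_C, map_mul,
        PowerSeries.rescale_rescale]
  have h := congrArg (fun p => PowerSeries.coeff k (Polynomial.coeff p j)) hinv
  simp only [Polynomial.coeff_map, PowerSeries.coeff_rescale] at h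
  have hne : ζ ^ k - 1 ≠ 0 := fun h0 => hk ((hζ.pow_eq_one_iff_dvd k).1 (sub_eq_zero.1 h0))
  have h2 : algebraMap ℂ R (ζ ^ k - 1) * PowerSeries.coeff k ((conjProd n α).coeff j) = 0 := by
    rw [map_sub, map_pow, map_one, sub_mul, one_mul, h, sub_self]
  have hu : IsUnit (algebraMap ℂ R (ζ ^ k - 1)) := (isUnit_iff_ne_zero.2 hne).map _
  exact hu.mul_right_eq_zero.1 h2

open Classical in
/-- The generic power series `α* = ∑_{i ∈ I} Aᵢ Tⁱ`. -/
def genericSeries {m : ℕ} (b : Fin (m + 1) → ℕ) : (PolyA b)⟦X⟧ :=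
  PowerSeries.mk fun i => if h : i ∈ I b then MvPolynomial.X ⟨i, h⟩ else 0

/-- The polynomials `F_{ij} ∈ ℂ[A]`: the coefficients of the Weierstrass polynomial of the generic
series `α*`, as polynomials in the coefficients of `α*`. -/
def F {m : ℕ} (b : Fin (m + 1) → ℕ) (n : ℕ) (p : ℕ × ℕ) : PolyA b :=
  weierstrassCoeff n (genericSeries b) p.1 p.2

theorem map_weierstrassCoeff {R S : Type*} [CommRing R] [Algebra ℂ R] [CommRing S] [Algebra ℂ S]
    (φ : R →ₐ[ℂ] S) (n : ℕ) (α : R⟦X⟧) (i j : ℕ) :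
    φ (weierstrassCoeff n α i j) = weierstrassCoeff n (PowerSeries.map (φ : R →+* S) α) i j := by
  have key : (conjProd n α).map (PowerSeries.map (φ : R →+* S)) =
      conjProd n (PowerSeries.map (φ : R →+* S) α) := by
    unfold conjProd
    rw [Polynomial.map_prod]
    refine Finset.prod_congr rfl fun ε _ => ?_
    rw [Polynomial.map_sub, Polynomial.map_X, Polynomial.map_C]
    congr 2
    ext k
    simp [PowerSeries.coeff_rescale]
  unfold weierstrassCoeff
  rw [← key, Polynomial.coeff_map, PowerSeries.coeff_map]
  rfl

open Classical in
/-- `c_{ij} = F_{ij}(a)`: at `a = (aᵢ)_{i ∈ I}` the polynomial `F_{ij}` takes the value of the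
coefficient `c_{ij}` of the Weierstrass polynomial of the series `∑_{i ∈ I} aᵢ Tⁱ`. -/
theorem aeval_F {m : ℕ} (b : Fin (m + 1) → ℕ) (n : ℕ) (a : I b → ℂ) (i j : ℕ) :
    MvPolynomial.aeval a (F b n (i, j)) =
      weierstrassCoeff n (PowerSeries.mk fun l => if h : l ∈ I b then a ⟨l, h⟩ else 0) i j := by
  unfold F
  rw [map_weierstrassCoeff]
  congr 1
  ext l
  by_cases h : l ∈ I b <;> simp [genericSeries, h]

/-- The substitution `C = F`, sending `W ∈ ℂ[C]` to `W(F) ∈ ℂ[A]`. -/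
def substF {m : ℕ} (b : Fin (m + 1) → ℕ) (n : ℕ) : PolyC →ₐ[ℂ] PolyA b :=
  MvPolynomial.aeval (F b n)

end PlaneBranch

end

/-! Let `R` be the algebra generated by the `F_{ij}`, `M` the monomials in the `A_{b_k}`, and `S`
the fractions over `R` with denominator in `M ∩ R` (`fractionsOver`); the claim is that `Q` lies in
`S`. By Newton's identities the traces of the powers of the generic series α lie over `R`, hence so
do the coefficients of αᵏ at exponents divisible by `n` (`coeff_pow_mem`).

The ring E = `traceMultipliers` turns this into algebra: it contains α, `S` and `Tⁿ`, allows
division by `Tⁿ`, is T-adically closed, and its elements have coefficients in `S` at exponents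
divisible by `n`. Induction on i puts each term `Aᵢ Tⁱ` into E (`term_mem_traceMultipliers`).
Removing lower terms leaves β with leading term `Aᵢ Tⁱ`. If i is some `b_k`, an n-th root extraction
isolates that term. Otherwise Bézout modulo `n` gives a product `μ Tʳ` of earlier characteristic
terms and a power of `Tⁿ` with n ∣ r + i, so that `μ Aᵢ` is in `S`, and μ can be cancelled.

Each monomial of an invariant `Q` has weight divisible by `n`, so it is such a coefficient of a
product of terms. -/

noncomputable section

namespace PlaneBranch

/-! ### Newton's identities and traces. -/

section PowerSums

/-- Newton's identities: a subring which contains the coefficients of `∏ (X - rᵢ)` contains the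
power sums of the `rᵢ`. -/
theorem sum_pow_mem_of_coeff_prod_mem {A ι : Type*} [CommRing A] [Fintype ι] (S : Subring A)
    (r : ι → A) (h : ∀ j, (∏ i, (Polynomial.X - Polynomial.C (r i))).coeff j ∈ S) (k : ℕ) :
    ∑ i, r i ^ k ∈ S := by
  have hneg (l : ℕ) : (-1 : A) ^ l ∈ S := pow_mem (neg_mem (one_mem S)) l
  have hesymm (l : ℕ) : MvPolynomial.aeval r (MvPolynomial.esymm ι ℤ l) ∈ S := by
    rw [MvPolynomial.aeval_esymm_eq_multiset_esymm]
    set s := Finset.univ.val.map r with hs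
    by_cases hl : l ≤ Multiset.card s
    · have hv := s.prod_X_sub_C_coeff (Nat.sub_le (Multiset.card s) l)
      rw [Nat.sub_sub_self hl] at hv
      have h2 : s.esymm l = (-1) ^ l * (s.map fun t => Polynomial.X - Polynomial.C t).prod.coeff
          (Multiset.card s - l) := by
        rw [hv, ← mul_assoc, ← mul_pow]; simp
      rw [h2, hs, Multiset.map_map]
      exact mul_mem (hneg l) (h _)
    · rw [Multiset.esymm, Multiset.powersetCard_eq_empty _ (not_le.1 hl)]
      simp
  have hpsum : ∀ l, MvPolynomial.aeval r (MvPolynomial.psum ι ℤ l) ∈ S := by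
    intro l
    induction l using Nat.strong_induction_on with
    | _ l ih =>
      rcases Nat.eq_zero_or_pos l with rfl | hl
      · simp
      · rw [MvPolynomial.psum_eq_mul_esymm_sub_sum _ _ l hl, map_sub, map_sum]
        refine sub_mem ?_ (sum_mem fun a ha => ?_)
        · simp only [map_mul, map_pow, map_neg, map_one, map_natCast]
          exact mul_mem (mul_mem (hneg _) (natCast_mem S l)) (hesymm l)
        · simp only [map_mul, map_pow, map_neg, map_one]
          refine mul_mem (mul_mem (hneg _) (hesymm _)) (ih _ ?_)
          obtain ⟨ha1, ha2⟩ := Finset.mem_filter.1 ha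
          have ha3 := Finset.HasAntidiagonal.mem_antidiagonal.1 ha1
          have ha4 := ha2.1
          omega
  simpa [MvPolynomial.psum] using hpsum k

/-- The subring of the power series whose coefficients lie in a given subring. -/
def coeffSubring {A : Type*} [CommRing A] (S : Subring A) : Subring A⟦X⟧ where
  carrier := {h | ∀ i, PowerSeries.coeff i h ∈ S}
  zero_mem' i := by simp
  one_mem' i := by
    rw [PowerSeries.coeff_one]
    split_ifs
    exacts [one_mem S, zero_mem S]
  add_mem' hf hg i := by
    rw [map_add]
    exact add_mem (hf i) (hg i)
  neg_mem' hf i := by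
    rw [map_neg]
    exact neg_mem (hf i)
  mul_mem' hf hg i := by
    rw [PowerSeries.coeff_mul]
    exact sum_mem fun p _ => mul_mem (hf _) (hg _)

/-- The coefficients at `T^{nj}` of the powers of `α` are polynomials in the coefficients of the
Weierstrass polynomial. -/
theorem coeff_pow_mem {R : Type*} [CommRing R] [Algebra ℂ R] {n : ℕ} (hn : 0 < n) (α : R⟦X⟧)
    (S : Subalgebra ℂ R) (hS : ∀ i j, weierstrassCoeff n α i j ∈ S) (j k : ℕ) :
    PowerSeries.coeff (n * j) (α ^ k) ∈ S := by
  have hcoeff (l : ℕ) : (conjProd n α).coeff l ∈ coeffSubring S.toSubring := by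
    intro i
    by_cases hi : n ∣ i
    · obtain ⟨i, rfl⟩ := hi
      exact hS i l
    · rw [coeff_conjProd_eq_zero hn α l i hi]
      exact zero_mem _
  have hsum := sum_pow_mem_of_coeff_prod_mem (coeffSubring S.toSubring)
    (fun ε : Polynomial.nthRootsFinset n (1 : ℂ) =>
      PowerSeries.rescale (algebraMap ℂ R ε) α) (fun l => by
        rw [Finset.prod_coe_sort (Polynomial.nthRootsFinset n (1 : ℂ)) (fun ε =>
          Polynomial.X - Polynomial.C (PowerSeries.rescale (algebraMap ℂ R ε) α))]
        exact hcoeff l) k (n * j)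
  rw [Finset.sum_coe_sort (Polynomial.nthRootsFinset n (1 : ℂ)) (fun ε =>
    PowerSeries.rescale (algebraMap ℂ R ε) α ^ k), map_sum] at hsum
  -- Since εⁿ = 1, all conjugates agree at `T^{nj}`, so the trace there is n times the coefficient
  -- of αᵏ.
  have hterm : ∀ ε ∈ Polynomial.nthRootsFinset n (1 : ℂ),
      PowerSeries.coeff (n * j) (PowerSeries.rescale (algebraMap ℂ R ε) α ^ k) =
        PowerSeries.coeff (n * j) (α ^ k) := by
    intro ε hε
    rw [Polynomial.mem_nthRootsFinset hn] at hε
    rw [← map_pow, PowerSeries.coeff_rescale, ← map_pow, pow_mul, hε, one_pow, map_one, one_mul]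
  rw [Finset.sum_congr rfl hterm, Finset.sum_const,
    (Complex.isPrimitiveRoot_exp n hn.ne').card_nthRootsFinset] at hsum
  have hn0 : (n : ℂ) ≠ 0 := Nat.cast_ne_zero.2 hn.ne'
  have h := S.smul_mem hsum ((n : ℂ)⁻¹)
  rwa [← Nat.cast_smul_eq_nsmul ℂ, smul_smul, inv_mul_cancel₀ hn0, one_smul] at h

end PowerSums

/-! ### The ring of trace multipliers. -/

section TraceMultipliers

variable {K : Type*} [Field K] [Algebra ℂ K] (S : Subalgebra ℂ K) (n : ℕ) (α : K⟦X⟧)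

/-- The power series `h` for which the coefficients at `T^{nj}` of `h αᵏ` lie in `S`. -/
def traceDual : AddSubgroup K⟦X⟧ where
  carrier := {h | ∀ j k, PowerSeries.coeff (n * j) (h * α ^ k) ∈ S}
  zero_mem' j k := by simp
  add_mem' hf hg j k := by
    rw [add_mul, map_add]
    exact add_mem (hf j k) (hg j k)
  neg_mem' hf j k := by
    rw [neg_mul, map_neg]
    exact neg_mem (hf j k)

/-- The power series which multiply `traceDual S n α` into itself. -/
def traceMultipliers : Subring K⟦X⟧ where
  carrier := {h | ∀ g ∈ traceDual S n α, h * g ∈ traceDual S n α}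
  zero_mem' g _ := by
    rw [zero_mul]
    exact zero_mem _
  one_mem' g hg := by rwa [one_mul]
  add_mem' hf hh g hg := by
    rw [add_mul]
    exact add_mem (hf g hg) (hh g hg)
  neg_mem' hf g hg := by
    rw [neg_mul]
    exact neg_mem (hf g hg)
  mul_mem' hf hh g hg := by
    rw [mul_assoc]
    exact hf _ (hh g hg)

variable {S n α}

/-- Multiplication by α only shifts k, and `traceDual` quantifies over all k. -/
theorem self_mem_traceMultipliers : α ∈ traceMultipliers S n α := by
  intro g hg j k
  have h := hg j (k + 1)
  rwa [pow_succ', ← mul_assoc, mul_comm g] at h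

theorem C_mem_traceMultipliers {c : K} (hc : c ∈ S) :
    PowerSeries.C c ∈ traceMultipliers S n α := by
  intro g hg j k
  rw [mul_assoc, PowerSeries.coeff_C_mul]
  exact mul_mem hc (hg j k)

theorem X_pow_mem_traceMultipliers {r : ℕ} (hr : n ∣ r) :
    (PowerSeries.X ^ r : K⟦X⟧) ∈ traceMultipliers S n α := by
  obtain ⟨r, rfl⟩ := hr
  intro g hg j k
  rw [mul_assoc, PowerSeries.coeff_X_pow_mul', ← Nat.mul_sub]
  split_ifs
  exacts [hg _ k, zero_mem S]

theorem mem_traceMultipliers_of_X_pow_mul_mem {r : ℕ} (hr : n ∣ r) {h : K⟦X⟧}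
    (hh : PowerSeries.X ^ r * h ∈ traceMultipliers S n α) : h ∈ traceMultipliers S n α := by
  obtain ⟨r, rfl⟩ := hr
  intro g hg j k
  have h2 := hh g hg (j + r) k
  rwa [mul_assoc, mul_assoc, mul_add, PowerSeries.coeff_X_pow_mul, ← mul_assoc] at h2

/-- The hypothesis `hα` says that 1 lies in `traceDual`. -/
theorem coeff_mem_of_mem_traceMultipliers
    (hα : ∀ j k, PowerSeries.coeff (n * j) (α ^ k) ∈ S) {h : K⟦X⟧}
    (hh : h ∈ traceMultipliers S n α) {r : ℕ} (hr : n ∣ r) : PowerSeries.coeff r h ∈ S := by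
  obtain ⟨r, rfl⟩ := hr
  simpa using hh 1 (fun j k => by simpa using hα j k) r 0

/-- `traceMultipliers S n α` is closed in the `T`-adic topology. -/
theorem mem_traceMultipliers_of_forall_dvd {h : K⟦X⟧}
    (hh : ∀ N, ∃ f ∈ traceMultipliers S n α, PowerSeries.X ^ N ∣ f - h) :
    h ∈ traceMultipliers S n α := by
  intro g hg j k
  obtain ⟨f, hf, hdvd⟩ := hh (n * j + 1)
  have h1 : PowerSeries.X ^ (n * j + 1) ∣ f * g * α ^ k - h * g * α ^ k := by
    rw [← sub_mul, ← sub_mul]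
    exact (hdvd.mul_right _).mul_right _
  have h2 := PowerSeries.X_pow_dvd_iff.1 h1 (n * j) (Nat.lt_succ_self _)
  rw [map_sub, sub_eq_zero] at h2
  rw [← h2]
  exact hf g hg j k

theorem sq_dvd_one_add_pow_sub {A : Type*} [CommRing A] (x : A) (l : ℕ) :
    x ^ 2 ∣ (1 + x) ^ l - (1 + l * x) := by
  induction l with
  | zero => simp
  | succ l ih =>
    obtain ⟨y, hy⟩ := ih
    refine ⟨y * (1 + x) + l, ?_⟩
    rw [pow_succ, sub_eq_iff_eq_add.1 hy]
    push_cast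
    ring

/-- An `n`-th root extraction by Newton's iteration. -/
theorem leadingTerm_mem_traceMultipliers (hn : 0 < n) {a : K} (ha0 : a ≠ 0)
    (ha : (a ^ n)⁻¹ ∈ S) {i : ℕ} {β : K⟦X⟧} (hβ : β ∈ traceMultipliers S n α)
    (hdvd : PowerSeries.X ^ (i + 1) ∣ β - PowerSeries.C a * PowerSeries.X ^ i) :
    PowerSeries.C a * PowerSeries.X ^ i ∈ traceMultipliers S n α := by
  set x : K⟦X⟧ := PowerSeries.C a * PowerSeries.X ^ i with hx
  have hnK : algebraMap ℂ K n ≠ 0 := (map_ne_zero _).2 (Nat.cast_ne_zero.2 hn.ne')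
  have hCa : (PowerSeries.C a⁻¹ : K⟦X⟧) * PowerSeries.C a = 1 := by
    rw [← map_mul, inv_mul_cancel₀ ha0, map_one]
  have hCan : (PowerSeries.C (a ^ n)⁻¹ : K⟦X⟧) * PowerSeries.C a ^ n = 1 := by
    rw [← map_pow, ← map_mul, inv_mul_cancel₀ (pow_ne_zero n ha0), map_one]
  have happrox : ∀ l : ℕ, ∃ δ : K⟦X⟧, PowerSeries.X ^ (l + 1) ∣ δ ∧
      x * (1 + δ) ∈ traceMultipliers S n α := by
    intro l
    induction l with
    | zero =>
      obtain ⟨u, hu⟩ := hdvd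
      refine ⟨PowerSeries.C a⁻¹ * PowerSeries.X * u, ⟨PowerSeries.C a⁻¹ * u, by ring⟩, ?_⟩
      convert hβ using 1
      rw [sub_eq_iff_eq_add.1 hu, hx]
      linear_combination (PowerSeries.X ^ (i + 1) * u) * hCa
    | succ l ih =>
      obtain ⟨δ, hδ, hmem⟩ := ih
      obtain ⟨w, hw⟩ := sq_dvd_one_add_pow_sub δ n
      -- The n-th power of x(1 + δ) has scalar factor aⁿ and exponent in, both of which can be
      -- divided out.
      have hq : (1 + δ) ^ n - 1 ∈ traceMultipliers S n α := by
        refine mem_traceMultipliers_of_X_pow_mul_mem (r := i * n) (dvd_mul_left n i) ?_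
        have h1 := mul_mem (C_mem_traceMultipliers (n := n) (α := α) ha) (pow_mem hmem n)
        have h2 := sub_mem h1
          (X_pow_mem_traceMultipliers (S := S) (α := α) (dvd_mul_left n i))
        convert h2 using 1
        rw [hx, mul_pow, mul_pow, ← pow_mul]
        linear_combination (-PowerSeries.X ^ (i * n) * (1 + δ) ^ n) * hCan
      set ν : K⟦X⟧ := PowerSeries.C (algebraMap ℂ K (n : ℂ)⁻¹) with hν
      have hνn : ν * n = 1 := by
        rw [hν, map_inv₀, map_natCast, ← map_natCast (PowerSeries.C (R := K)), ← map_mul,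
          inv_mul_cancel₀ (by simpa using hnK), map_one]
      -- Newton step for yⁿ = 1 at y = 1 + δ: as yⁿ - 1 ≡ nδ modulo δ², the new error is divisible
      -- by δ².
      refine ⟨(1 + δ) * (1 - ν * ((1 + δ) ^ n - 1)) - 1, ?_, ?_⟩
      · have h1 : (1 + δ) * (1 - ν * ((1 + δ) ^ n - 1)) - 1 =
            δ ^ 2 * (-1 - ν * w * (1 + δ)) := by
          rw [sub_eq_iff_eq_add.1 hw]
          linear_combination (-(1 + δ) * δ) * hνn
        rw [h1]
        refine Dvd.dvd.mul_right (dvd_trans (pow_dvd_pow _ (by omega : l + 1 + 1 ≤ (l + 1) * 2)) ?_) _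
        rw [pow_mul]
        exact pow_dvd_pow_of_dvd hδ 2
      · rw [add_sub_cancel, ← mul_assoc]
        exact mul_mem hmem (sub_mem (one_mem _)
          (mul_mem (C_mem_traceMultipliers (S.algebraMap_mem _)) hq))
  refine mem_traceMultipliers_of_forall_dvd fun N => ?_
  obtain ⟨δ, hδ, hmem⟩ := happrox N
  refine ⟨_, hmem, ?_⟩
  rw [mul_add, mul_one, add_sub_cancel_left]
  exact ((pow_dvd_pow _ N.le_succ).trans hδ).mul_left _

end TraceMultipliers

/-! ### Bézout modulo n. -/

section Semigroup

/-- Bézout's identity modulo `n` with coefficients in `ℕ`. -/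
theorem exists_mem_dvd_add_of_gcd_dvd {ι : Type*} (Γ : AddSubmonoid ℕ) {n : ℕ} (hn : 0 < n)
    (s : Finset ι) (f : ι → ℕ) (hf : ∀ j ∈ s, f j ∈ Γ) {i : ℕ} (hi : s.gcd f ∣ i) :
    ∃ r ∈ Γ, n ∣ r + i := by
  let H : AddSubgroup ℤ :=
    { carrier := {z | ∃ r ∈ Γ, (n : ℤ) ∣ r - z}
      zero_mem' := ⟨0, zero_mem Γ, by simp⟩
      add_mem' := by
        rintro y z ⟨r, hr, hry⟩ ⟨t, ht, htz⟩
        refine ⟨r + t, add_mem hr ht, ?_⟩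
        rw [Nat.cast_add, add_sub_add_comm]
        exact dvd_add hry htz
      neg_mem' := by
        rintro z ⟨r, hr, hrz⟩
        -- Modulo n, (n - 1)r is -r, so residues of a submonoid form a group.
        refine ⟨(n - 1) • r, nsmul_mem hr _, ?_⟩
        have h : (((n - 1) • r : ℕ) : ℤ) - -z = n * r - (r - z) := by
          rw [smul_eq_mul, Nat.cast_mul, Nat.cast_sub hn]
          push_cast
          ring
        rw [h]
        exact dvd_sub (dvd_mul_right _ _) hrz }
  obtain ⟨g, hg⟩ := Int.subgroup_cyclic H
  have hmem (z : ℤ) : z ∈ H ↔ g ∣ z := by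
    rw [hg, ← AddSubgroup.zmultiples_eq_closure, Int.mem_zmultiples_iff]
  have hgi : g ∣ -(i : ℤ) := by
    rw [dvd_neg, ← Int.natAbs_dvd, Int.natCast_dvd_natCast]
    refine (Finset.dvd_gcd fun j hj => ?_).trans hi
    rw [← Int.natCast_dvd_natCast, Int.natAbs_dvd, ← hmem]
    exact ⟨f j, hf j hj, by simp⟩
  obtain ⟨r, hr, hri⟩ := (hmem _).2 hgi
  refine ⟨r, hr, ?_⟩
  rw [sub_neg_eq_add] at hri
  exact_mod_cast hri

end Semigroup

/-! ### Fractions with monomial denominators. -/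

section Denominators

variable {K : Type*} [Field K] [Algebra ℂ K]

/-- The elements of `K` which are brought into `R` by a denominator in `M ∩ R`. -/
def fractionsOver (M : Submonoid K) (R : Subalgebra ℂ K) : Subalgebra ℂ K where
  carrier := {q | ∃ μ ∈ M, μ ∈ R ∧ μ * q ∈ R}
  mul_mem' := by
    rintro p q ⟨μ, hμ, hμR, hp⟩ ⟨ν, hν, hνR, hq⟩
    refine ⟨μ * ν, mul_mem hμ hν, mul_mem hμR hνR, ?_⟩
    rw [mul_mul_mul_comm]
    exact mul_mem hp hq
  add_mem' := by
    rintro p q ⟨μ, hμ, hμR, hp⟩ ⟨ν, hν, hνR, hq⟩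
    refine ⟨μ * ν, mul_mem hμ hν, mul_mem hμR hνR, ?_⟩
    have h : μ * ν * (p + q) = ν * (μ * p) + μ * (ν * q) := by ring
    rw [h]
    exact add_mem (mul_mem hνR hp) (mul_mem hμR hq)
  algebraMap_mem' c := ⟨1, one_mem M, one_mem R, by simp⟩

theorem le_fractionsOver (M : Submonoid K) (R : Subalgebra ℂ K) : R ≤ fractionsOver M R :=
  fun q hq => ⟨1, one_mem M, one_mem R, by rwa [one_mul]⟩

/-- If μ clears q, then μq is itself in `M ∩ R` and clears q⁻¹. -/
theorem inv_mem_fractionsOver {M : Submonoid K} {R : Subalgebra ℂ K} {q : K} (hqM : q ∈ M)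
    (hq0 : q ≠ 0) (hq : q ∈ fractionsOver M R) : q⁻¹ ∈ fractionsOver M R := by
  obtain ⟨μ, hμ, hμR, hμq⟩ := hq
  refine ⟨μ * q, mul_mem hμ hqM, hμq, ?_⟩
  rwa [mul_assoc, mul_inv_cancel₀ hq0, mul_one]

end Denominators

/-! ### Isolating the terms of the series. -/

section Terms

variable {K : Type*} [Field K]

/-- As k grows, `e b k` can only get smaller in divisibility, so the sets being minimised shrink. -/
theorem IsCharacteristic.le_of_le {m n : ℕ} {α : ℂ⟦X⟧} {b : Fin (m + 1) → ℕ}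
    (hb : IsCharacteristic n α b) {j k : Fin m} (hjk : j ≤ k) : b j.succ ≤ b k.succ := by
  refine (hb.isLeast j).2 ⟨(hb.isLeast k).1.1, fun h => (hb.isLeast k).1.2 ?_⟩
  refine dvd_trans (Finset.dvd_gcd fun l hl => Finset.gcd_dvd (Finset.mem_Iic.2 ?_)) h
  exact (Finset.mem_Iic.1 hl).trans hjk

theorem pow_eq_C_mul_X_pow (a : K) (i l : ℕ) :
    (PowerSeries.C a * PowerSeries.X ^ i : K⟦X⟧) ^ l =
      PowerSeries.C (a ^ l) * PowerSeries.X ^ (i * l) := by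
  rw [mul_pow, ← pow_mul, map_pow]

/-- If `T^{i+1}` divides `β - a Tⁱ` then `aˡ` is the coefficient of `βˡ` at `T^{il}`. -/
theorem coeff_pow_of_dvd {a : K} {i : ℕ} {β : K⟦X⟧}
    (h : PowerSeries.X ^ (i + 1) ∣ β - PowerSeries.C a * PowerSeries.X ^ i) (l : ℕ) :
    PowerSeries.coeff (i * l) (β ^ l) = a ^ l := by
  obtain ⟨u, hu⟩ := h
  have hβ : β = PowerSeries.X ^ i * (PowerSeries.C a + PowerSeries.X * u) := by
    rw [sub_eq_iff_eq_add.1 hu]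
    ring
  rw [hβ, mul_pow, ← pow_mul]
  have h2 := PowerSeries.coeff_X_pow_mul
    ((PowerSeries.C a + PowerSeries.X * u) ^ l) (i * l) 0
  rw [zero_add] at h2
  rw [h2, PowerSeries.coeff_zero_eq_constantCoeff_apply]
  simp

/-- All terms of the series `α = ∑ aᵢ Tⁱ` belong to the ring of trace multipliers, if `S` contains
the inverses of the elements of `S` which are products of the characteristic coefficients. -/
theorem term_mem_traceMultipliers [Algebra ℂ K] {m n : ℕ} (hn : 0 < n) {b : Fin (m + 1) → ℕ} (hb0 : b 0 = n)
    (hmono : ∀ j k : Fin m, j ≤ k → b j.succ ≤ b k.succ) {S : Subalgebra ℂ K} {a : ℕ → K}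
    (ha : ∀ i, i ∉ I b → a i = 0) {M : Submonoid K} (hM0 : ∀ μ ∈ M, μ ≠ 0)
    (haM : ∀ k : Fin m, a (b k.succ) ∈ M) (hinv : ∀ μ ∈ M, μ ∈ S → μ⁻¹ ∈ S)
    (hα : ∀ j k, PowerSeries.coeff (n * j) (PowerSeries.mk a ^ k) ∈ S) (i : ℕ) :
    PowerSeries.C (a i) * PowerSeries.X ^ i ∈ traceMultipliers S n (PowerSeries.mk a) := by
  induction i using Nat.strong_induction_on with
  | _ i ih =>
  by_cases hiI : i ∈ I b
  swap
  · rw [ha i hiI, map_zero, zero_mul]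
    exact zero_mem _
  set E := traceMultipliers S n (PowerSeries.mk a) with hE
  obtain ⟨β, hβ, hdvd⟩ : ∃ β ∈ E,
      PowerSeries.X ^ (i + 1) ∣ β - PowerSeries.C (a i) * PowerSeries.X ^ i := by
    refine ⟨PowerSeries.mk a - ∑ j ∈ Finset.range i, PowerSeries.C (a j) * PowerSeries.X ^ j,
      sub_mem self_mem_traceMultipliers (sum_mem fun j hj => ih j (Finset.mem_range.1 hj)), ?_⟩
    rw [sub_sub, ← Finset.sum_range_succ, PowerSeries.X_pow_dvd_iff]
    intro l hl
    simp only [map_sub, map_sum, PowerSeries.coeff_mk, PowerSeries.coeff_C_mul,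
      PowerSeries.coeff_X_pow, mul_ite, mul_one, mul_zero, Finset.sum_ite_eq, Finset.mem_range,
      if_pos hl, sub_self]
  by_cases hib : ∃ k : Fin m, b k.succ = i
  · obtain ⟨k, hk⟩ := hib
    have hai : a i ∈ M := hk ▸ haM k
    have hpow : a i ^ n ∈ S := by
      rw [← coeff_pow_of_dvd hdvd n]
      exact coeff_mem_of_mem_traceMultipliers hα (pow_mem hβ n) (dvd_mul_left n i)
    exact leadingTerm_mem_traceMultipliers hn (hM0 _ hai) (hinv _ (pow_mem hai n) hpow) hβ hdvd
  -- Exponents r for which some `μ Tʳ` with μ in `M` is already known to be in E.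
  · let Γ : AddSubmonoid ℕ :=
      { carrier := {r | ∃ μ ∈ M, PowerSeries.C μ * PowerSeries.X ^ r ∈ E}
        zero_mem' := ⟨1, one_mem M, by simp⟩
        add_mem' := by
          rintro r t ⟨μ, hμ, hr⟩ ⟨ν, hν, ht⟩
          refine ⟨μ * ν, mul_mem hμ hν, ?_⟩
          rw [map_mul, pow_add, mul_mul_mul_comm]
          exact mul_mem hr ht }
    have hnΓ : b 0 ∈ Γ := ⟨1, one_mem M, by
      rw [map_one, one_mul, hb0]
      exact X_pow_mem_traceMultipliers dvd_rfl⟩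
    have hbΓ (k : Fin m) (hk : b k.succ < i) : b k.succ ∈ Γ := ⟨_, haM k, ih _ hk⟩
    obtain ⟨r, ⟨μ, hμ, hμE⟩, hr⟩ : ∃ r ∈ Γ, n ∣ r + i := by
      rcases hiI with ⟨-, h⟩ | h
      · refine exists_mem_dvd_add_of_gcd_dvd Γ hn _ b (fun j hj => ?_) h
        rw [Finset.mem_Iic, Fin.le_zero_iff] at hj
        rwa [hj]
      · obtain ⟨k, hdk, hki⟩ := Set.mem_iUnion.1 h
        refine exists_mem_dvd_add_of_gcd_dvd Γ hn _ b (fun j hj => ?_) hdk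
        induction j using Fin.cases with
        | zero => exact hnΓ
        | succ j =>
          rw [Finset.mem_Iic, Fin.succ_le_succ_iff] at hj
          -- Strict, because i is not a characteristic exponent.
          exact hbΓ j (lt_of_le_of_ne ((hmono j k hj).trans hki) fun h => hib ⟨j, h⟩)
    have hμa : μ * a i ∈ S := by
      have h := coeff_mem_of_mem_traceMultipliers hα (mul_mem hμE hβ) hr
      rw [mul_assoc, PowerSeries.coeff_C_mul, add_comm, PowerSeries.coeff_X_pow_mul] at h
      convert h using 2
      simpa using (coeff_pow_of_dvd hdvd 1).symm
    have hμn : μ ^ n ∈ S := by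
      have h := coeff_mem_of_mem_traceMultipliers hα (pow_mem hμE n) (dvd_mul_left n r)
      rw [pow_eq_C_mul_X_pow, PowerSeries.coeff_C_mul, PowerSeries.coeff_X_pow_self,
        mul_one] at h
      exact h
    have hμn' := hinv _ (pow_mem hμ n) hμn
    refine mem_traceMultipliers_of_X_pow_mul_mem (dvd_mul_left n r) ?_
    have h1 : PowerSeries.C (μ * a i) * PowerSeries.X ^ (r + i) ∈ E :=
      mul_mem (C_mem_traceMultipliers hμa) (X_pow_mem_traceMultipliers hr)
    -- μ⁻ⁿ (μTʳ)ⁿ⁻¹ · μ aᵢ Tʳ⁺ⁱ = Tʳⁿ · aᵢ Tⁱ, and `T^{rn}` cancels.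
    have h2 := mul_mem (C_mem_traceMultipliers (n := n) (α := PowerSeries.mk a) hμn')
      (mul_mem (pow_mem hμE (n - 1)) h1)
    convert h2 using 1
    obtain ⟨l, rfl⟩ : ∃ l, n = l + 1 := ⟨n - 1, by omega⟩
    have hC : (PowerSeries.C (μ ^ (l + 1))⁻¹ : K⟦X⟧) * PowerSeries.C μ ^ (l + 1) = 1 := by
      rw [← map_pow, ← map_mul, inv_mul_cancel₀ (pow_ne_zero _ (hM0 _ hμ)), map_one]
    rw [Nat.add_sub_cancel, pow_eq_C_mul_X_pow, map_mul, map_pow]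
    linear_combination (-PowerSeries.X ^ (r * (l + 1) + i) * PowerSeries.C (a i)) * hC

end Terms

/-! ### Weights of invariant monomials. -/

section Monomials

/-- A monomial of a `U_n`-invariant polynomial has weight divisible by `n`. -/
theorem IsUInvariant.dvd_weight {m n : ℕ} (hn : 0 < n) {b : Fin (m + 1) → ℕ} {Q : PolyA b}
    (hQ : IsUInvariant b n Q) {d : I b →₀ ℕ} (hd : d ∈ Q.support) :
    n ∣ d.sum fun i l => (i : ℕ) * l := by
  have hζ := Complex.isPrimitiveRoot_exp n hn.ne'
  set ζ := Complex.exp (2 * Real.pi * Complex.I / n)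
  have hmon (u : I b →₀ ℕ) (c : ℂ) :
      MvPolynomial.aeval (fun i : I b => MvPolynomial.C (ζ ^ (i : ℕ)) * MvPolynomial.X i)
        (MvPolynomial.monomial u c) =
      (MvPolynomial.monomial u (c * ζ ^ (u.sum fun i l => (i : ℕ) * l)) : PolyA b) := by
    rw [MvPolynomial.aeval_monomial, MvPolynomial.monomial_eq, map_mul, mul_assoc]
    congr 1
    simp only [Finsupp.prod, Finsupp.sum, mul_pow, Finset.prod_mul_distrib,
      ← Finset.prod_pow_eq_pow_sum, pow_mul, map_prod, map_pow]
  have hcoeff : MvPolynomial.coeff d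
      (MvPolynomial.aeval (fun i : I b => MvPolynomial.C (ζ ^ (i : ℕ)) * MvPolynomial.X i) Q) =
      MvPolynomial.coeff d Q * ζ ^ (d.sum fun i l => (i : ℕ) * l) := by
    conv_lhs => rw [Q.as_sum, map_sum]
    simp only [hmon, MvPolynomial.coeff_sum, MvPolynomial.coeff_monomial]
    rw [Finset.sum_ite_eq', if_pos hd]
  rw [hQ ζ hζ.pow_eq_one] at hcoeff
  have hne := MvPolynomial.mem_support_iff.1 hd
  exact (hζ.pow_eq_one_iff_dvd _).1 (mul_left_cancel₀ hne (by rw [← hcoeff, mul_one]))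

end Monomials

end PlaneBranch

end

/-! ### The theorem. -/

open PlaneBranch in
theorem theorem4p6 {m : ℕ} (n : ℕ) (α : PowerSeries ℂ)
    (hα : PlaneBranch.IsPuiseuxParametrisation n α)
    (b : Fin (m + 1) → ℕ) (hb : PlaneBranch.IsCharacteristic n α b)
    (Q : PlaneBranch.PolyA b) (hQ : PlaneBranch.IsUInvariant b n Q) :
    ∃ V W : PlaneBranch.PolyC,
      (∃ d : Fin m → ℕ, PlaneBranch.substF b n V = ∏ k, PlaneBranch.varAb b k ^ d k) ∧
      PlaneBranch.substF b n V ≠ 0 ∧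
      algebraMap (PlaneBranch.PolyA b) (FractionRing (PlaneBranch.PolyA b)) Q =
        algebraMap (PlaneBranch.PolyA b) (FractionRing (PlaneBranch.PolyA b))
            (PlaneBranch.substF b n W) /
          algebraMap (PlaneBranch.PolyA b) (FractionRing (PlaneBranch.PolyA b))
            (PlaneBranch.substF b n V) := by
  classical
  have hn := hα.pos
  let K := FractionRing (PolyA b)
  let φ : PolyA b →ₐ[ℂ] K := IsScalarTower.toAlgHom ℂ (PolyA b) K
  have hφ : Function.Injective φ := IsFractionRing.injective (PolyA b) K
  let N : Submonoid (PolyA b) := Submonoid.closure (Set.range (varAb b))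
  have hN (μ : PolyA b) (hμ : μ ∈ N) : ∃ d : Fin m → ℕ, μ = ∏ k, varAb b k ^ d k := by
    obtain ⟨d, hd⟩ := Submonoid.exists_of_mem_closure_range _ _ hμ
    exact ⟨d, hd⟩
  have hN0 (μ : PolyA b) (hμ : μ ∈ N) : μ ≠ 0 := by
    obtain ⟨d, rfl⟩ := hN μ hμ
    exact Finset.prod_ne_zero_iff.2 fun k _ => pow_ne_zero _ (MvPolynomial.X_ne_zero _)
  let M : Submonoid K := N.map φ
  have hM0 (μ : K) (hμ : μ ∈ M) : μ ≠ 0 := by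
    obtain ⟨ν, hν, rfl⟩ := hμ
    exact (map_ne_zero_iff φ hφ).2 (hN0 ν hν)
  let R : Subalgebra ℂ K := (substF b n).range.map φ
  let S := fractionsOver M R
  let a : ℕ → K := fun i => φ (PowerSeries.coeff i (genericSeries b))
  have hcoeff (i : I b) : PowerSeries.coeff (i : ℕ) (genericSeries b) = MvPolynomial.X i := by
    rw [genericSeries, PowerSeries.coeff_mk, dif_pos i.2]
  have hmk : PowerSeries.mk a = PowerSeries.map (φ : PolyA b →+* K) (genericSeries b) := by
    ext i
    simp [a]
  have hS (j k : ℕ) : PowerSeries.coeff (n * j) (PowerSeries.mk a ^ k) ∈ S := by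
    refine le_fractionsOver M R ?_
    rw [hmk, ← map_pow, PowerSeries.coeff_map]
    refine Subalgebra.mem_map.2 ⟨_, coeff_pow_mem hn _ _ (fun i j => ?_) j k, rfl⟩
    exact ⟨MvPolynomial.X (i, j), by simp [substF, F]⟩
  have hterm := term_mem_traceMultipliers (K := K) hn hb.zero_eq (fun j k => hb.le_of_le)
    (S := S) (a := a) (M := M)
    (fun i hi => by simp only [a, genericSeries, PowerSeries.coeff_mk, dif_neg hi, map_zero]) hM0
    (fun k => ⟨varAb b k, Submonoid.subset_closure ⟨k, rfl⟩, by
      simp only [a]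
      rw [hcoeff ⟨b k.succ, mem_I b k⟩]
      rfl⟩)
    (fun μ hμ hμS => inv_mem_fractionsOver hμ (hM0 μ hμ) hμS) hS
  have hQS : φ Q ∈ S := by
    rw [Q.as_sum, map_sum]
    refine sum_mem fun d hd => ?_
    -- The monomial with exponent d is the coefficient of this product at T to its weight.
    have hd' := prod_mem (S := traceMultipliers S n (PowerSeries.mk a)) (t := d.support)
      (f := fun i => (PowerSeries.C (a i) * PowerSeries.X ^ (i : ℕ)) ^ d i)
      fun i _ => pow_mem (hterm i) _
    have h := coeff_mem_of_mem_traceMultipliers hS hd' (hQ.dvd_weight hn hd)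
    simp only [pow_eq_C_mul_X_pow, Finset.prod_mul_distrib, Finset.prod_pow_eq_pow_sum,
      ← map_prod] at h
    rw [PowerSeries.coeff_C_mul, Finsupp.sum, PowerSeries.coeff_X_pow_self, mul_one] at h
    rw [MvPolynomial.monomial_eq, ← MvPolynomial.algebraMap_eq, map_mul, φ.commutes]
    refine mul_mem (S.algebraMap_mem _) ?_
    simpa only [Finsupp.prod, map_prod, map_pow, a, hcoeff] using h
  obtain ⟨_, ⟨μ, hμ, rfl⟩, hμR, hμQ⟩ := hQS
  obtain ⟨_, ⟨V, rfl⟩, hV⟩ := Subalgebra.mem_map.1 hμR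
  obtain ⟨_, ⟨W, rfl⟩, hW⟩ := Subalgebra.mem_map.1 hμQ
  have hVμ : substF b n V = μ := hφ hV
  have hWQ : substF b n W = μ * Q := hφ (hW.trans (map_mul φ μ Q).symm)
  refine ⟨V, W, hVμ ▸ hN μ hμ, hVμ ▸ hN0 μ hμ, ?_⟩
  rw [hVμ, hWQ, map_mul, mul_div_cancel_left₀]
  exact (map_ne_zero_iff φ hφ).2 (hN0 μ hμ)
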